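/- Let $(\Omega,\mathcal F,P)$ be a probability space such that $L_2(\Omega,\mathcal F,P)$ is separable, and let $\Lambda$ be the lattice of all sub-$\sigma$-fields of $\mathcal F$ that contain all null sets of $\mathcal F$, ordered by inclusion; $\mathcal E_1\vee\mathcal E_2$ denotes the $\sigma$-field generated by $\mathcal E_1\cup\mathcal E_2$. The trivial $\sigma$-field consists of the null sets and their complements. A *noise-type Boolean algebra* is a sublattice $B\subset\Lambda$ containing the trivial $\sigma$-field and $\mathcal F$, such that $B$ is a Boolean algebra and any two $\sigma$-fields of $B$ whose intersection is trivial are independent. A set $Z\subset\Lambda$ is *monotonically closed* if $\bigcap_n\mathcal E_n\in Z$ for every decreasing sequence $(\mathcal E_n)$ in $Z$ and $\bigvee_n\mathcal E_n\in Z$ for every increasing sequence $(\mathcal E_n)$ in $Z$. The *noise-type completion* of a noise-type Boolean algebra $B$ is the greatest (with respect to inclusion) among all noise-type Boolean algebras $C\supset B$ such that every monotonically closed set containing $B$ contains $C$. **Theorem.** Let $B\subset\Lambda$ be a noise-type Boolean algebra, and let $\tilde B$ be the least monotonically closed subset of $\Lambda$ containing $B$. Then $B$ has a noise-type completion $C$,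 and a $\sigma$-field $\mathcal E\in\Lambda$ belongs to $C$ if and only if (a) $\mathcal E\in\tilde B$, and (b) $\mathcal E$ has a complement in $\tilde B$, that is, there is $\mathcal E'\in\tilde B$ such that $\mathcal E\cap\mathcal E'$ is the trivial $\sigma$-field and $\mathcal E\vee\mathcal E'=\mathcal F$. Moreover, for each $\mathcal E\in\tilde B$ there is at most one such $\mathcal E'$. -/

import Mathlib

open MeasureTheory

namespace NoiseAlgebra

/-- The set `Λ` of all sub-σ-fields of `F` containing all `F`-measurable null sets. It is ordered by
inclusion; finite (and nonempty infinite) meets and joins in `Λ` are those of `MeasurableSpace Ω`: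
`⊓`, `⨅` are intersections and `⊔`, `⨆` are generated σ-fields. -/
def Lam {Ω : Type*} {F : MeasurableSpace Ω} (μ : Measure Ω) : Set (MeasurableSpace Ω) :=
  {E | E ≤ F ∧ ∀ s : Set Ω, MeasurableSet[F] s → μ s = 0 → MeasurableSet[E] s}

/-- The trivial σ-field: only the null sets and their complements. -/
def trivialField {Ω : Type*} {F : MeasurableSpace Ω} (μ : Measure Ω) : MeasurableSpace Ω where
  MeasurableSet' s := MeasurableSet[F] s ∧ (μ s = 0 ∨ μ sᶜ = 0)
  measurableSet_empty := ⟨MeasurableSet.empty, Or.inl measure_empty⟩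
  measurableSet_compl s hs := ⟨hs.1.compl, by rw [compl_compl]; exact hs.2.symm⟩
  measurableSet_iUnion f hf := by
    refine ⟨MeasurableSet.iUnion fun i => (hf i).1, ?_⟩
    by_cases h : ∃ i, μ (f i)ᶜ = 0
    · obtain ⟨i, hi⟩ := h
      exact Or.inr (measure_mono_null (Set.compl_subset_compl.2 (Set.subset_iUnion f i)) hi)
    · push Not at h
      exact Or.inl (measure_iUnion_null fun i => (hf i).2.resolve_right (h i))

/-- `E` and `E'` are complements of each other: their intersection is the trivial σ-field, and
together they generate the whole `F`. -/
def IsComplementPair {Ω : Type*} {F : MeasurableSpace Ω} (μ : Measure Ω)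
    (E E' : MeasurableSpace Ω) : Prop :=
  E ⊓ E' = trivialField μ ∧ E ⊔ E' = F

/-- A noise-type Boolean algebra: a sublattice of `Λ` containing the trivial σ-field and the whole
`F`, which is a Boolean algebra (a distributive lattice with complements), and in which any two
σ-fields with trivial intersection are independent. -/
structure IsNoiseTypeBooleanAlgebra {Ω : Type*} {F : MeasurableSpace Ω} (μ : Measure Ω)
    (B : Set (MeasurableSpace Ω)) : Prop where
  subset_lam : B ⊆ Lam μ
  inf_mem : ∀ x ∈ B, ∀ y ∈ B, x ⊓ y ∈ B
  sup_mem : ∀ x ∈ B, ∀ y ∈ B, x ⊔ y ∈ B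
  trivial_mem : trivialField μ ∈ B
  whole_mem : F ∈ B
  distrib : ∀ x ∈ B, ∀ y ∈ B, ∀ z ∈ B, x ⊓ (y ⊔ z) = (x ⊓ y) ⊔ (x ⊓ z)
  exists_compl : ∀ x ∈ B, ∃ x' ∈ B, IsComplementPair μ x x'
  indep : ∀ x ∈ B, ∀ y ∈ B, x ⊓ y = trivialField μ → ProbabilityTheory.Indep x y μ

/-- A subset of `Λ` is monotonically closed if it contains the intersection of every decreasing
sequence of its elements, and the σ-field generated by every increasing sequence of its elements. -/
structure IsMonotonicallyClosed {Ω : Type*} {F : MeasurableSpace Ω} (μ : Measure Ω)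
    (Z : Set (MeasurableSpace Ω)) : Prop where
  subset_lam : Z ⊆ Lam μ
  iInf_mem : ∀ E : ℕ → MeasurableSpace Ω, Antitone E → (∀ n, E n ∈ Z) → ⨅ n, E n ∈ Z
  iSup_mem : ∀ E : ℕ → MeasurableSpace Ω, Monotone E → (∀ n, E n ∈ Z) → ⨆ n, E n ∈ Z

/-- `B₁` is monotonically dense in `B₂` if every monotonically closed subset of `Λ` containing `B₁`
contains also `B₂`. -/
def IsMonotonicallyDense {Ω : Type*} {F : MeasurableSpace Ω} (μ : Measure Ω)
    (B₁ B₂ : Set (MeasurableSpace Ω)) : Prop :=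
  ∀ Z : Set (MeasurableSpace Ω), IsMonotonicallyClosed μ Z → B₁ ⊆ Z → B₂ ⊆ Z

/-- `C` is the noise-type completion of `B`: the greatest among all noise-type Boolean algebras that
contain `B` and in which `B` is monotonically dense. -/
def IsNoiseTypeCompletion {Ω : Type*} {F : MeasurableSpace Ω} (μ : Measure Ω)
    (B C : Set (MeasurableSpace Ω)) : Prop :=
  IsGreatest {D | IsNoiseTypeBooleanAlgebra μ D ∧ B ⊆ D ∧ IsMonotonicallyDense μ B D} C

/-- The least monotonically closed subset of `Λ` containing `B` (for `B ⊆ Λ`), as the intersection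
of all of them. -/
def monotoneClosure {Ω : Type*} {F : MeasurableSpace Ω} (μ : Measure Ω)
    (B : Set (MeasurableSpace Ω)) : Set (MeasurableSpace Ω) :=
  ⋂₀ {Z | IsMonotonicallyClosed μ Z ∧ B ⊆ Z}

theorem isMonotonicallyClosed_lam {Ω : Type*} {F : MeasurableSpace Ω} (μ : Measure Ω) :
    IsMonotonicallyClosed μ (Lam μ) where
  subset_lam := subset_rfl
  iInf_mem E _ h := ⟨(iInf_le E 0).trans (h 0).1, fun s hs h0 => by
    rw [MeasurableSpace.measurableSet_iInf]
    exact fun n => (h n).2 s hs h0⟩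
  iSup_mem E _ h := ⟨iSup_le fun n => (h n).1, fun s hs h0 => le_iSup E 0 s ((h 0).2 s hs h0)⟩

theorem isLeast_monotoneClosure {Ω : Type*} {F : MeasurableSpace Ω} (μ : Measure Ω)
    (B : Set (MeasurableSpace Ω)) (hB : B ⊆ Lam μ) :
    IsLeast {Z | IsMonotonicallyClosed μ Z ∧ B ⊆ Z} (monotoneClosure μ B) :=
  ⟨⟨⟨Set.sInter_subset_of_mem ⟨isMonotonicallyClosed_lam μ, hB⟩,
      fun E hE h Z hZ => hZ.1.iInf_mem E hE fun n => h n Z hZ,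
      fun E hE h Z hZ => hZ.1.iSup_mem E hE fun n => h n Z hZ⟩,
    Set.subset_sInter fun _ hZ => hZ.2⟩,
    fun _ hZ => Set.sInter_subset_of_mem hZ⟩

end NoiseAlgebra

/-! Write B̃ for the monotone closure and C for its complemented elements (`completion`). A
noise-type Boolean algebra in which B is monotonically dense lies in B̃ and contains complements of
its elements, so it lies in C. What remains is that C is itself a noise-type Boolean algebra, and
that complements in B̃ are unique.

Lattice identities need not survive monotone limits of σ-fields, but identities between conditional
expectations do, by martingale convergence in L¹ in both directions. Two such identities carry the
proof. First, the conditional expectations of elements of B commute, hence so do those of B̃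
(`comm_of_mem_monotoneClosure`); therefore B̃ is closed under intersection, and trivial intersection
in B̃ forces independence. Second, if x, z in B̃ intersect trivially, they are conditionally
independent given every y in B̃ (`condIndepGiven`); this yields y ⊓ (x ⊔ z) = (y ⊓ x) ⊔ (y ⊓ z),
hence uniqueness of complements and distributivity in C.

Joins with a complemented x respect decreasing limits, because x ⊔ y = x ⊔ (y ⊓ x') and joins inside
two independent σ-fields do (`iInf_sup_eq_of_indep`). So C is closed under joins, and by De Morgan
it is closed under complements and meets. -/

namespace NoiseAlgebra

open Filter Topology ProbabilityTheory

/-! ### σ-fields containing the null sets, and their conditional expectations -/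

section Basic

variable {Ω : Type*} {x y m F : MeasurableSpace Ω} {μ : Measure Ω}

/-- The indicator function of a set, with real values. -/
noncomputable abbrev ind (A : Set Ω) : Ω → ℝ := A.indicator fun _ => 1

theorem inf_mem_lam (hx : x ∈ Lam μ) (hy : y ∈ Lam μ) : x ⊓ y ∈ Lam μ :=
  ⟨inf_le_left.trans hx.1, fun s hs h0 =>
    MeasurableSpace.measurableSet_inf.2 ⟨hx.2 s hs h0, hy.2 s hs h0⟩⟩

theorem sup_mem_lam (hx : x ∈ Lam μ) (hy : y ∈ Lam μ) : x ⊔ y ∈ Lam μ :=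
  ⟨sup_le hx.1 hy.1, fun s hs h0 => (le_sup_left : x ≤ x ⊔ y) s (hx.2 s hs h0)⟩

theorem iInf_mem_lam {ι : Type*} [Nonempty ι] {E : ι → MeasurableSpace Ω}
    (hE : ∀ i, E i ∈ Lam μ) : ⨅ i, E i ∈ Lam μ :=
  ⟨(iInf_le E (Classical.arbitrary ι)).trans (hE _).1, fun s hs h0 => by
    rw [MeasurableSpace.measurableSet_iInf]
    exact fun i => (hE i).2 s hs h0⟩

theorem trivialField_le (hx : x ∈ Lam μ) : trivialField μ ≤ x := by
  rintro s ⟨hs, h0 | h0⟩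
  · exact hx.2 s hs h0
  · exact (hx.2 sᶜ hs.compl h0).of_compl

theorem measurableSet_of_ae_eq (hx : x ∈ Lam μ) {s t : Set Ω} (hs : MeasurableSet[x] s)
    (ht : MeasurableSet[F] t) (hst : s =ᵐ[μ] t) : MeasurableSet[x] t := by
  have h1 : MeasurableSet[x] (t \ s) :=
    hx.2 _ (ht.diff (hx.1 s hs)) (ae_le_set.1 hst.symm.le)
  have h2 : MeasurableSet[x] (s \ t) :=
    hx.2 _ ((hx.1 s hs).diff ht) (ae_le_set.1 hst.le)
  have : t = (s \ (s \ t)) ∪ (t \ s) := by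
    ext ω
    simp only [Set.mem_union, Set.mem_sdiff]
    tauto
  rw [this]
  exact (hs.diff h2).union h1

/-- An `F`-measurable function that agrees almost everywhere with an `x`-measurable one is itself
`x`-measurable. -/
theorem measurable_of_ae_eq (hx : x ∈ Lam μ) {f g : Ω → ℝ} (hf : Measurable[x] f)
    (hg : Measurable[F] g) (hfg : f =ᵐ[μ] g) : Measurable[x] g := fun _ ht =>
  measurableSet_of_ae_eq hx (hf ht) (hg ht) (hfg.preimage _)

theorem measurableSet_of_condExp_ind (hx : x ∈ Lam μ) {A : Set Ω} (hA : MeasurableSet[F] A)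
    (h : μ[ind A|x] =ᵐ[μ] ind A) : MeasurableSet[x] A := by
  have h1 : Measurable[x] (ind A) :=
    measurable_of_ae_eq hx stronglyMeasurable_condExp.measurable
      (measurable_const.indicator hA) h
  have h2 : A = ind A ⁻¹' {1} := by
    ext ω
    by_cases hω : ω ∈ A <;> simp [hω]
  rw [h2]
  exact h1 (measurableSet_singleton 1)

/-- Turns an inclusion of σ-fields into identities of conditional expectations, which can be proved
by passing to limits. -/
theorem le_of_condExp_ind (hx : x ≤ F) (hy : y ∈ Lam μ)
    (h : ∀ A, MeasurableSet[x] A → μ[ind A|y] =ᵐ[μ] ind A) : x ≤ y :=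
  fun A hA => measurableSet_of_condExp_ind hy (hx A hA) (h A hA)

theorem abs_condExp_ind_le (x : MeasurableSpace Ω) (A : Set Ω) :
    ∀ᵐ ω ∂μ, |(μ[ind A|x]) ω| ≤ 1 := by
  refine ae_bdd_abs_condExp_of_ae_bdd_abs (Eventually.of_forall fun ω => ?_)
  by_cases hω : ω ∈ A <;> simp [hω]

variable [IsProbabilityMeasure μ]

theorem integrable_ind {A : Set Ω} (hA : MeasurableSet[F] A) : Integrable (ind A) μ :=
  (integrable_const 1).indicator hA

theorem condExp_eq_self (hx : x ≤ F) {f : Ω → ℝ} (hf : StronglyMeasurable[x] f)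
    (hfi : Integrable f μ) : μ[f|x] =ᵐ[μ] f :=
  (condExp_of_stronglyMeasurable hx hf hfi).eventuallyEq

theorem condExp_ind_self (hx : x ≤ F) {A : Set Ω} (hA : MeasurableSet[x] A) :
    μ[ind A|x] =ᵐ[μ] ind A :=
  condExp_eq_self hx (stronglyMeasurable_const.indicator hA) (integrable_ind (hx A hA))

/-- A function measurable (up to null sets) with respect to each of several σ-fields of `Λ` is
measurable with respect to their intersection. -/
theorem condExp_iInf_eq_self {ι : Type*} [Nonempty ι] {E : ι → MeasurableSpace Ω}
    (hE : ∀ i, E i ∈ Lam μ) {f : Ω → ℝ} (h : ∀ i, μ[f|E i] =ᵐ[μ] f) :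
    μ[f|⨅ i, E i] =ᵐ[μ] f := by
  let i₀ : ι := Classical.arbitrary ι
  -- One version serves all `i`: it agrees a.e. with an `E i`-measurable function, and `E i`
  -- contains the null sets.
  have hg : Measurable[⨅ i, E i] (μ[f|E i₀]) := by
    intro t ht
    rw [MeasurableSpace.measurableSet_iInf]
    intro i
    exact measurable_of_ae_eq (hE i) stronglyMeasurable_condExp.measurable
      (stronglyMeasurable_condExp.measurable.mono (hE i₀).1 le_rfl)
      ((h i).trans (h i₀).symm) ht
  calc μ[f|⨅ i, E i] =ᵐ[μ] μ[μ[f|E i₀]|⨅ i, E i] := condExp_congr_ae (h i₀).symm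
    _ =ᵐ[μ] μ[f|E i₀] := condExp_eq_self (iInf_mem_lam hE).1 hg.stronglyMeasurable
      integrable_condExp
    _ =ᵐ[μ] f := h i₀

theorem condExp_inf_eq_self (hx : x ∈ Lam μ) (hy : y ∈ Lam μ) {f : Ω → ℝ}
    (h1 : μ[f|x] =ᵐ[μ] f) (h2 : μ[f|y] =ᵐ[μ] f) : μ[f|x ⊓ y] =ᵐ[μ] f := by
  rw [inf_eq_iInf]
  exact condExp_iInf_eq_self (by rintro (_ | _) <;> assumption) (by rintro (_ | _) <;> assumption)

end Basic

/-! ### Martingale convergence in L¹ -/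

section Convergence

variable {Ω : Type*} {F : MeasurableSpace Ω} {μ : Measure Ω}

/-- Convergence in mean. -/
def TendstoL1 (μ : Measure Ω) (u : ℕ → Ω → ℝ) (v : Ω → ℝ) : Prop :=
  Tendsto (fun n => eLpNorm (u n - v) 1 μ) atTop (𝓝 0)

theorem TendstoL1.congr {u u' : ℕ → Ω → ℝ} {v v' : Ω → ℝ} (h : TendstoL1 μ u v)
    (hu : ∀ n, u n =ᵐ[μ] u' n) (hv : v =ᵐ[μ] v') : TendstoL1 μ u' v' := by
  have : (fun n => eLpNorm (u' n - v') 1 μ) = fun n => eLpNorm (u n - v) 1 μ :=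
    funext fun n => eLpNorm_congr_ae ((hu n).symm.sub hv.symm)
  rw [TendstoL1, this]
  exact h

theorem TendstoL1.unique {u : ℕ → Ω → ℝ} {v v' : Ω → ℝ} (h : TendstoL1 μ u v)
    (h' : TendstoL1 μ u v') (hu : ∀ n, Integrable (u n) μ) (hv : Integrable v μ)
    (hv' : Integrable v' μ) : v =ᵐ[μ] v' := by
  have hle : ∀ n, eLpNorm (v - v') 1 μ ≤ eLpNorm (u n - v) 1 μ + eLpNorm (u n - v') 1 μ := by
    intro n
    have : v - v' = (u n - v') - (u n - v) := by abel
    rw [this, add_comm]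
    exact eLpNorm_sub_le ((hu n).sub hv').1 ((hu n).sub hv).1 le_rfl
  have h0 : eLpNorm (v - v') 1 μ ≤ 0 := by
    have := h.add h'
    rw [add_zero] at this
    exact ge_of_tendsto' this hle
  have := (eLpNorm_eq_zero_iff (hv.sub hv').1 one_ne_zero).1 (le_antisymm h0 zero_le)
  exact (sub_ae_eq_zero _ _).1 this

theorem tendstoL1_const (v : Ω → ℝ) : TendstoL1 μ (fun _ => v) v := by
  simp [TendstoL1]

theorem TendstoL1.condExp {u : ℕ → Ω → ℝ} {v : Ω → ℝ} (h : TendstoL1 μ u v)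
    (hu : ∀ n, Integrable (u n) μ) (hv : Integrable v μ) (m : MeasurableSpace Ω) :
    TendstoL1 μ (fun n => μ[u n|m]) (μ[v|m]) := by
  refine tendsto_of_tendsto_of_tendsto_of_le_of_le tendsto_const_nhds h (fun _ => zero_le)
    fun n => ?_
  calc eLpNorm (μ[u n|m] - μ[v|m]) 1 μ = eLpNorm (μ[u n - v|m]) 1 μ :=
        eLpNorm_congr_ae (condExp_sub (hu n) hv m).symm
    _ ≤ eLpNorm (u n - v) 1 μ := eLpNorm_condExp_le_eLpNorm _ le_rfl

/-- Since uu' - vv' = u(u' - v') + v'(u - v), only `u n` and `v'` need to be bounded. -/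
theorem TendstoL1.mul {u u' : ℕ → Ω → ℝ} {v v' : Ω → ℝ} (h : TendstoL1 μ u v)
    (h' : TendstoL1 μ u' v') (hu : ∀ n, Integrable (u n) μ) (hv : Integrable v μ)
    (hu' : ∀ n, Integrable (u' n) μ) (hv' : Integrable v' μ)
    (hb : ∀ n, ∀ᵐ ω ∂μ, |u n ω| ≤ 1) (hb' : ∀ᵐ ω ∂μ, |v' ω| ≤ 1) :
    TendstoL1 μ (fun n => u n * u' n) (v * v') := by
  have hlim : Tendsto (fun n => eLpNorm (u' n - v') 1 μ + eLpNorm (u n - v) 1 μ) atTop (𝓝 0) := by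
    simpa using h'.add h
  refine tendsto_of_tendsto_of_tendsto_of_le_of_le tendsto_const_nhds hlim (fun _ => zero_le)
    fun n => ?_
  have h1 : AEStronglyMeasurable (u n * (u' n - v')) μ := (hu n).1.mul ((hu' n).sub hv').1
  have h2 : AEStronglyMeasurable (v' * (u n - v)) μ := hv'.1.mul ((hu n).sub hv).1
  have : u n * u' n - v * v' = u n * (u' n - v') + v' * (u n - v) := by ring
  calc eLpNorm (u n * u' n - v * v') 1 μ
      = eLpNorm (u n * (u' n - v') + v' * (u n - v)) 1 μ := by rw [this]
    _ ≤ eLpNorm (u n * (u' n - v')) 1 μ + eLpNorm (v' * (u n - v)) 1 μ :=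
        eLpNorm_add_le h1 h2 le_rfl
    _ ≤ _ := by
        refine add_le_add (eLpNorm_mono_ae ?_) (eLpNorm_mono_ae ?_)
        · filter_upwards [hb n] with ω hω
          rw [Pi.mul_apply, norm_mul]
          exact mul_le_of_le_one_left (norm_nonneg _) hω
        · filter_upwards [hb'] with ω hω
          rw [Pi.mul_apply, norm_mul]
          exact mul_le_of_le_one_left (norm_nonneg _) hω

variable [IsProbabilityMeasure μ]

/-- Upward martingale convergence. -/
theorem tendstoL1_condExp_iSup {E : ℕ → MeasurableSpace Ω} (hmono : Monotone E)
    (hE : ∀ n, E n ≤ F) (f : Ω → ℝ) : TendstoL1 μ (fun n => μ[f|E n]) (μ[f|⨆ n, E n]) :=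
  tendsto_eLpNorm_condExp (ℱ := ⟨E, hmono, hE⟩) f

/-- On L² these are projections onto decreasing closed subspaces; the projections onto the
increasing orthogonal complements converge, hence so do these. The limit lies in every subspace. -/
theorem exists_tendstoL1_condExp_of_antitone {E : ℕ → MeasurableSpace Ω} (hanti : Antitone E)
    (hE : ∀ n, E n ≤ F) {f : Ω → ℝ} (hf : MemLp f 2 μ) :
    ∃ g : Ω → ℝ, Integrable g μ ∧ (∀ n, μ[g|E n] =ᵐ[μ] g) ∧
      TendstoL1 μ (fun n => μ[f|E n]) g := by
  let K : ℕ → Submodule ℝ (Lp ℝ 2 μ) := fun n => lpMeas ℝ ℝ (E n) 2 μ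
  have : ∀ n, Fact (E n ≤ F) := fun n => ⟨hE n⟩
  have : ∀ n, (K n).HasOrthogonalProjection := fun n => by
    dsimp only [K]
    infer_instance
  have hKanti : Antitone K := fun i j hij φ hφ => by
    rw [mem_lpMeas_iff_aestronglyMeasurable] at hφ ⊢
    exact hφ.mono (hanti hij)
  let φ : Lp ℝ 2 μ := hf.toLp
  have hmono : Monotone fun n => (K n)ᗮ := fun i j hij => Submodule.orthogonal_le (hKanti hij)
  obtain ⟨ψ, hψ⟩ : ∃ ψ, Tendsto (fun n => (K n).starProjection φ) atTop (𝓝 ψ) := by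
    have := Submodule.starProjection_tendsto_closure_iSup (fun n => (K n)ᗮ) hmono φ
    refine ⟨_, (tendsto_const_nhds (x := φ)).sub this |>.congr fun n => ?_⟩
    rw [Submodule.starProjection_orthogonal]
    simp
  have hψK : ∀ n, ψ ∈ K n := fun n => by
    have hcl : IsClosed (K n : Set (Lp ℝ 2 μ)) := by
      rw [← (K n).orthogonal_orthogonal]
      exact Submodule.isClosed_orthogonal _
    refine hcl.mem_of_tendsto hψ ?_
    filter_upwards [eventually_ge_atTop n] with k hk
    exact hKanti hk (Submodule.starProjection_apply_mem _ _)
  have hint : Integrable (ψ : Ω → ℝ) μ := (Lp.memLp ψ).integrable one_le_two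
  refine ⟨ψ, hint, fun n => ?_, ?_⟩
  · exact condExp_of_aestronglyMeasurable' (hE n)
      (mem_lpMeas_iff_aestronglyMeasurable.1 (hψK n)) hint
  · rw [Lp.tendsto_Lp_iff_tendsto_eLpNorm'] at hψ
    refine tendsto_of_tendsto_of_tendsto_of_le_of_le tendsto_const_nhds hψ (fun _ => zero_le)
      fun n => ?_
    have hae : ((K n).starProjection φ : Ω → ℝ) =ᵐ[μ] μ[f|E n] :=
      hf.condExpL2_ae_eq_condExp (𝕜 := ℝ) (hE n)
    calc eLpNorm (μ[f|E n] - (ψ : Ω → ℝ)) 1 μ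
        ≤ eLpNorm (μ[f|E n] - (ψ : Ω → ℝ)) 2 μ :=
          eLpNorm_le_eLpNorm_of_exponent_le one_le_two (integrable_condExp.sub hint).1
      _ = _ := eLpNorm_congr_ae (hae.symm.sub (EventuallyEq.refl _ _))

/-- Downward martingale convergence. -/
theorem tendstoL1_condExp_iInf {E : ℕ → MeasurableSpace Ω} (hanti : Antitone E)
    (hE : ∀ n, E n ∈ Lam μ) {f : Ω → ℝ} (hf : Integrable f μ) :
    TendstoL1 μ (fun n => μ[f|E n]) (μ[f|⨅ n, E n]) := by
  have hle : ∀ n, E n ≤ F := fun n => (hE n).1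
  have hL2 : ∀ f : Ω → ℝ, MemLp f 2 μ → TendstoL1 μ (fun n => μ[f|E n]) (μ[f|⨅ n, E n]) := by
    intro f hf
    obtain ⟨g, hg, hgE, hlim⟩ := exists_tendstoL1_condExp_of_antitone hanti hle hf
    -- Conditioning the limit `g` on the infimum identifies it: the approximants all become E[f|⨅ E
    -- n], while `g` is unchanged.
    have h1 := hlim.condExp (fun n => integrable_condExp) hg (⨅ n, E n)
    have h2 : TendstoL1 μ (fun _ => μ[f|⨅ n, E n]) (μ[g|⨅ n, E n]) :=
      h1.congr (fun n => condExp_condExp_of_le (iInf_le E n) (hle n)) (EventuallyEq.refl _ _)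
    have h3 := (tendstoL1_const _).unique h2 (fun _ => integrable_condExp) integrable_condExp
      integrable_condExp
    exact hlim.congr (fun _ => EventuallyEq.refl _ _)
      ((h3.trans (condExp_iInf_eq_self hE hgE)).symm)
  -- From L² to L¹ by density of simple functions, conditioning being an L¹ contraction.
  rw [TendstoL1, ENNReal.tendsto_nhds_zero]
  intro ε hε
  have hε3 : ε / 3 ≠ 0 := (ENNReal.div_pos hε.ne' (by simp)).ne'
  obtain ⟨s, hs, hsL⟩ := (memLp_one_iff_integrable.2 hf).exists_simpleFunc_eLpNorm_sub_lt
    ENNReal.one_ne_top hε3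
  have hs2 : MemLp s 2 μ := s.memLp_of_isFiniteMeasure 2 μ
  have hsi : Integrable s μ := memLp_one_iff_integrable.1 hsL
  have hcond : ∀ m : MeasurableSpace Ω, eLpNorm (μ[f|m] - μ[s|m]) 1 μ ≤ ε / 3 := fun m =>
    calc eLpNorm (μ[f|m] - μ[s|m]) 1 μ = eLpNorm (μ[f - ⇑s|m]) 1 μ :=
          eLpNorm_congr_ae (condExp_sub hf hsi m).symm
      _ ≤ eLpNorm (f - ⇑s) 1 μ := eLpNorm_condExp_le_eLpNorm _ le_rfl
      _ ≤ ε / 3 := hs.le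
  have hlim := hL2 s hs2
  rw [TendstoL1, ENNReal.tendsto_nhds_zero] at hlim
  filter_upwards [hlim (ε / 3) (pos_iff_ne_zero.2 hε3)] with n hn
  have hdec : μ[f|E n] - μ[f|⨅ n, E n] = ((μ[f|E n] - μ[s|E n]) + (μ[s|E n] - μ[s|⨅ n, E n]))
      - (μ[f|⨅ n, E n] - μ[s|⨅ n, E n]) := by abel
  have hi : ∀ (g : Ω → ℝ) (m : MeasurableSpace Ω), AEStronglyMeasurable[F] (μ[g|m]) μ :=
    fun g m => (integrable_condExp (f := g) (m := m) (μ := μ)).1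
  calc eLpNorm (μ[f|E n] - μ[f|⨅ n, E n]) 1 μ
      ≤ eLpNorm ((μ[f|E n] - μ[s|E n]) + (μ[s|E n] - μ[s|⨅ n, E n])) 1 μ
        + eLpNorm (μ[f|⨅ n, E n] - μ[s|⨅ n, E n]) 1 μ := by
          rw [hdec]
          exact eLpNorm_sub_le (((hi _ _).sub (hi _ _)).add ((hi _ _).sub (hi _ _)))
            ((hi _ _).sub (hi _ _)) le_rfl
    _ ≤ (ε / 3 + ε / 3) + ε / 3 := by
          refine add_le_add ((eLpNorm_add_le ((hi _ _).sub (hi _ _)) ((hi _ _).sub (hi _ _))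
            le_rfl).trans (add_le_add (hcond _) hn)) (hcond _)
    _ = ε := ENNReal.add_thirds ε

end Convergence

/-! ### Set integrals, self-adjointness and π-systems -/

section SetIntegral

variable {Ω : Type*} {a b w y y' m F : MeasurableSpace Ω} {μ : Measure Ω}

theorem integral_ind_mul {S : Set Ω} (hS : MeasurableSet[F] S) (f : Ω → ℝ) :
    ∫ ω, ind S ω * f ω ∂μ = ∫ ω in S, f ω ∂μ := by
  rw [← integral_indicator hS]
  congr 1 with ω
  by_cases h : ω ∈ S <;> simp [h]

theorem ind_inter (A A' : Set Ω) : ind (A ∩ A') = ind A * ind A' := by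
  ext ω
  by_cases h : ω ∈ A <;> by_cases h' : ω ∈ A' <;> simp [h, h']

theorem sup_eq_generateFrom_inter (a b : MeasurableSpace Ω) :
    a ⊔ b = MeasurableSpace.generateFrom
      (Set.image2 (· ∩ ·) {s | MeasurableSet[a] s} {t | MeasurableSet[b] t}) := by
  refine le_antisymm (sup_le ?_ ?_) (MeasurableSpace.generateFrom_le ?_)
  · exact fun s hs => MeasurableSpace.measurableSet_generateFrom
      ⟨s, hs, Set.univ, MeasurableSet.univ, Set.inter_univ s⟩
  · exact fun s hs => MeasurableSpace.measurableSet_generateFrom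
      ⟨Set.univ, MeasurableSet.univ, s, hs, Set.univ_inter s⟩
  · rintro _ ⟨s, hs, t, ht, rfl⟩
    exact MeasurableSet.inter ((le_sup_left : a ≤ a ⊔ b) s hs) ((le_sup_right : b ≤ a ⊔ b) t ht)

theorem isPiSystem_inter (a b : MeasurableSpace Ω) :
    IsPiSystem (Set.image2 (· ∩ ·) {s | MeasurableSet[a] s} {t | MeasurableSet[b] t}) := by
  rintro _ ⟨s, hs, t, ht, rfl⟩ _ ⟨s', hs', t', ht', rfl⟩ _
  exact ⟨s ∩ s', MeasurableSet.inter hs hs', t ∩ t', MeasurableSet.inter ht ht',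
    Set.inter_inter_inter_comm _ _ _ _⟩

/-- An integral that vanishes over a π-system and over the whole space vanishes over the generated
σ-field. -/
theorem setIntegral_eq_zero_of_isPiSystem {C : Set (Set Ω)} (hC : IsPiSystem C)
    (hm : m = MeasurableSpace.generateFrom C) (hmF : m ≤ F) {φ : Ω → ℝ} (hφ : Integrable φ μ)
    (huniv : ∫ ω, φ ω ∂μ = 0) (h : ∀ A ∈ C, ∫ ω in A, φ ω ∂μ = 0) {A : Set Ω}
    (hA : MeasurableSet[m] A) : ∫ ω in A, φ ω ∂μ = 0 := by
  induction A, hA using MeasurableSpace.induction_on_inter hm hC with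
  | empty => simp
  | basic t ht => exact h t ht
  | compl t ht ih =>
    have := integral_add_compl (hmF t ht) hφ
    rw [ih, huniv, zero_add] at this
    exact this
  | iUnion f hd hf ih =>
    rw [integral_iUnion (fun i => hmF _ (hf i)) hd hφ.integrableOn]
    simp [ih]

theorem integrable_condExp_ind_mul (m : MeasurableSpace Ω) (S : Set Ω) {f : Ω → ℝ}
    (hf : Integrable f μ) : Integrable (μ[ind S|m] * f) μ :=
  hf.bdd_mul integrable_condExp.1 (abs_condExp_ind_le m S)

theorem setIntegral_ind_comm {S T : Set Ω} (hS : MeasurableSet[F] S) (hT : MeasurableSet[F] T) :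
    ∫ ω in S, ind T ω ∂μ = ∫ ω in T, ind S ω ∂μ := by
  rw [← integral_ind_mul hS, ← integral_ind_mul hT]
  simp_rw [mul_comm]

theorem integrable_ind_mul {S : Set Ω} (hS : MeasurableSet[F] S) {f : Ω → ℝ}
    (hf : Integrable f μ) : Integrable (ind S * f) μ :=
  hf.bdd_mul (c := 1) (measurable_const.indicator hS).aestronglyMeasurable
    (Eventually.of_forall fun ω => by by_cases hω : ω ∈ S <;> simp [hω])

variable [IsProbabilityMeasure μ]

/-- Conditional expectation is self-adjoint. -/
theorem setIntegral_condExp_eq (hm : m ≤ F) {S : Set Ω} (hS : MeasurableSet[F] S) {f : Ω → ℝ}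
    (hf : Integrable f μ) :
    ∫ ω in S, (μ[f|m]) ω ∂μ = ∫ ω, (μ[ind S|m]) ω * f ω ∂μ := by
  have hi : Integrable (ind S * μ[f|m]) μ :=
    integrable_ind_mul hS integrable_condExp
  calc ∫ ω in S, (μ[f|m]) ω ∂μ = ∫ ω, (ind S * μ[f|m]) ω ∂μ := (integral_ind_mul hS _).symm
    _ = ∫ ω, (μ[ind S * μ[f|m]|m]) ω ∂μ := (integral_condExp hm).symm
    _ = ∫ ω, (μ[ind S|m] * μ[f|m]) ω ∂μ := integral_congr_ae
        (condExp_mul_of_stronglyMeasurable_right stronglyMeasurable_condExp hi (integrable_ind hS))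
    _ = ∫ ω, (μ[μ[ind S|m] * f|m]) ω ∂μ := integral_congr_ae
        (condExp_mul_of_stronglyMeasurable_left stronglyMeasurable_condExp
          (integrable_condExp_ind_mul m S hf) hf).symm
    _ = _ := integral_condExp hm

theorem setIntegral_condExp_ind_comm (hm : m ≤ F) {S T : Set Ω} (hS : MeasurableSet[F] S)
    (hT : MeasurableSet[F] T) :
    ∫ ω in S, (μ[ind T|m]) ω ∂μ = ∫ ω in T, (μ[ind S|m]) ω ∂μ := by
  rw [setIntegral_condExp_eq hm hS (integrable_ind hT), ← integral_ind_mul hT]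
  simp_rw [mul_comm]

theorem condExp_eq_of_forall_setIntegral (hm : m ≤ F) {f g : Ω → ℝ} (hf : Integrable f μ)
    (hg : Integrable g μ) (hgm : μ[g|m] =ᵐ[μ] g)
    (h : ∀ S, MeasurableSet[m] S → ∫ ω in S, g ω ∂μ = ∫ ω in S, f ω ∂μ) :
    μ[f|m] =ᵐ[μ] g := by
  refine (ae_eq_condExp_of_forall_setIntegral_eq hm hf (fun _ _ _ => hg.integrableOn)
    (fun S hS _ => h S hS) ?_).symm
  exact stronglyMeasurable_condExp.aestronglyMeasurable.congr hgm

/-- Coincidence of two nested conditional expectations on a π-system extends to the generated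
σ-field. -/
theorem condExp_ind_eq_of_isPiSystem {C : Set (Set Ω)} (hC : IsPiSystem C)
    (hm : m = MeasurableSpace.generateFrom C) (hmF : m ≤ F) (hwy : w ≤ y) (hy : y ≤ F)
    (h : ∀ A ∈ C, μ[ind A|y] =ᵐ[μ] μ[ind A|w]) {A : Set Ω} (hA : MeasurableSet[m] A) :
    μ[ind A|y] =ᵐ[μ] μ[ind A|w] := by
  have hw : w ≤ F := hwy.trans hy
  refine condExp_eq_of_forall_setIntegral hy (integrable_ind (hmF A hA)) integrable_condExp
    (condExp_eq_self hy (stronglyMeasurable_condExp.mono hwy) integrable_condExp) fun T hT => ?_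
  have hTF := hy T hT
  -- Self-adjointness moves `A` into the domain of integration; for fixed `T` the claim is then the
  -- vanishing of an integral over `A`, which extends from the π-system.
  rw [setIntegral_condExp_ind_comm hw hTF (hmF A hA), setIntegral_ind_comm hTF (hmF A hA),
    ← sub_eq_zero, ← integral_sub integrable_condExp.integrableOn (integrable_ind hTF).integrableOn]
  refine setIntegral_eq_zero_of_isPiSystem hC hm hmF
    (φ := fun ω => (μ[ind T|w]) ω - ind T ω) (integrable_condExp.sub (integrable_ind hTF))
    ?_ (fun S hS => ?_) hA
  · rw [integral_sub integrable_condExp (integrable_ind hTF), integral_condExp hw, sub_self]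
  · have hSF : MeasurableSet[F] S :=
      hmF S (hm ▸ MeasurableSpace.measurableSet_generateFrom hS)
    rw [integral_sub integrable_condExp.integrableOn (integrable_ind hTF).integrableOn,
      setIntegral_condExp_ind_comm hw hSF hTF, sub_eq_zero, setIntegral_ind_comm hSF hTF,
      ← setIntegral_condExp hy (integrable_ind hSF) hT]
    exact setIntegral_congr_ae hTF ((h S hS).symm.mono fun ω hω _ => hω)

theorem condExp_ind_eq_of_sup (hab : a ⊔ b ≤ F) (hwy : w ≤ y) (hy : y ≤ F)
    (h : ∀ A A', MeasurableSet[a] A → MeasurableSet[b] A' →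
      μ[ind (A ∩ A')|y] =ᵐ[μ] μ[ind (A ∩ A')|w]) {S : Set Ω} (hS : MeasurableSet[a ⊔ b] S) :
    μ[ind S|y] =ᵐ[μ] μ[ind S|w] := by
  refine condExp_ind_eq_of_isPiSystem (isPiSystem_inter a b) (sup_eq_generateFrom_inter a b) hab
    hwy hy ?_ hS
  rintro _ ⟨A, hA, A', hA', rfl⟩
  exact h A A' hA hA'

theorem condExp_ind_inter_of_indep (hy : y ≤ F) (hy' : y' ≤ F) (hind : Indep y' y μ)
    {A A' : Set Ω} (hA : MeasurableSet[y] A) (hA' : MeasurableSet[y'] A') :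
    μ[ind (A ∩ A')|y] =ᵐ[μ] fun ω => ind A ω * μ.real A' := by
  have h1 : μ[ind A * ind A'|y] =ᵐ[μ] ind A * μ[ind A'|y] :=
    condExp_mul_of_stronglyMeasurable_left (stronglyMeasurable_const.indicator hA)
      (by rw [← ind_inter]; exact integrable_ind ((hy A hA).inter (hy' A' hA')))
      (integrable_ind (hy' A' hA'))
  have h2 : μ[ind A'|y] =ᵐ[μ] fun _ => ∫ ω, ind A' ω ∂μ :=
    condExp_indep_eq hy' hy (stronglyMeasurable_const.indicator hA') hind
  rw [ind_inter]
  filter_upwards [h1, h2] with ω h1 h2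
  rw [h1, Pi.mul_apply, h2]
  congr 1
  exact integral_indicator_one (hy' A' hA')

end SetIntegral

/-! ### Commuting conditional expectations -/

section Comm

variable {Ω : Type*} {x y y' F : MeasurableSpace Ω} {μ : Measure Ω}

/-- Two σ-fields commute if their conditional expectation operators do. -/
def Comm (μ : Measure Ω) (x y : MeasurableSpace Ω) : Prop :=
  ∀ f : Ω → ℝ, Integrable f μ → μ[μ[f|y]|x] =ᵐ[μ] μ[μ[f|x]|y]

theorem Comm.symm (h : Comm μ x y) : Comm μ y x := fun f hf => (h f hf).symm

variable [IsProbabilityMeasure μ]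

/-- The product of commuting projections is the projection onto the intersection of their ranges. -/
theorem Comm.condExp_condExp (h : Comm μ x y) (hx : x ∈ Lam μ) (hy : y ∈ Lam μ) {f : Ω → ℝ}
    (hf : Integrable f μ) : μ[μ[f|y]|x] =ᵐ[μ] μ[f|x ⊓ y] := by
  have h1 : μ[μ[μ[f|y]|x]|x] =ᵐ[μ] μ[μ[f|y]|x] :=
    condExp_eq_self hx.1 stronglyMeasurable_condExp integrable_condExp
  have h2 : μ[μ[μ[f|y]|x]|y] =ᵐ[μ] μ[μ[f|y]|x] :=
    (condExp_congr_ae (h f hf)).trans ((condExp_eq_self hy.1 stronglyMeasurable_condExp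
      integrable_condExp).trans (h f hf).symm)
  exact (condExp_inf_eq_self hx hy h1 h2).symm.trans
    ((condExp_condExp_of_le inf_le_left hx.1).trans (condExp_condExp_of_le inf_le_right hy.1))

/-- The hypothesis is the adjoint of the conclusion: it describes conditioning on `x` and then on
`y`. -/
theorem condExp_condExp_of_forall_ind (hx : x ≤ F) (hy : y ≤ F)
    (h : ∀ A, MeasurableSet[x] A → μ[ind A|y] =ᵐ[μ] μ[ind A|x ⊓ y]) {f : Ω → ℝ}
    (hf : Integrable f μ) : μ[μ[f|y]|x] =ᵐ[μ] μ[f|x ⊓ y] := by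
  refine condExp_eq_of_forall_setIntegral hx integrable_condExp integrable_condExp
    (condExp_eq_self hx (stronglyMeasurable_condExp.mono inf_le_left) integrable_condExp)
    fun S hS => ?_
  rw [setIntegral_condExp_eq hy (hx S hS) hf,
    setIntegral_condExp_eq (inf_le_left.trans hx) (hx S hS) hf]
  refine integral_congr_ae ?_
  filter_upwards [h S hS] with ω hω
  rw [hω]

/-- For S in x ⊓ y and S' in x ⊓ y', conditioning the indicator of S ∩ S' on `y` or on `x ⊓ y` gives
the same function, the indicator of S times P(S'). Such intersections generate `x`. -/
theorem condExp_ind_of_eq_sup (hx : x ≤ F) (hy : y ≤ F) (hy' : y' ≤ F) (hind : Indep y' y μ)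
    (hxy : x = (x ⊓ y) ⊔ (x ⊓ y')) {A : Set Ω} (hA : MeasurableSet[x] A) :
    μ[ind A|y] =ᵐ[μ] μ[ind A|x ⊓ y] := by
  refine condExp_ind_eq_of_sup (hxy ▸ hx) inf_le_right hy (fun S S' hS hS' => ?_) (hxy ▸ hA)
  exact (condExp_ind_inter_of_indep hy hy' hind (inf_le_right (a := x) S hS)
    (inf_le_right (a := x) S' hS')).trans (condExp_ind_inter_of_indep (inf_le_right.trans hy) hy'
    (indep_of_indep_of_le_right hind inf_le_right) hS (inf_le_right (a := x) S' hS')).symm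

theorem Comm.iSup {E : ℕ → MeasurableSpace Ω} (hmono : Monotone E) (hE : ∀ n, E n ∈ Lam μ)
    (h : ∀ n, Comm μ (E n) y) : Comm μ (⨆ n, E n) y := fun f hf => by
  have hle : ∀ n, E n ≤ F := fun n => (hE n).1
  have h1 := tendstoL1_condExp_iSup (μ := μ) hmono hle (μ[f|y])
  have h2 := (tendstoL1_condExp_iSup (μ := μ) hmono hle f).condExp
    (fun _ => integrable_condExp) integrable_condExp y
  exact h1.unique (h2.congr (fun n => (h n f hf).symm) (EventuallyEq.refl _ _))
    (fun _ => integrable_condExp) integrable_condExp integrable_condExp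

theorem Comm.iInf {E : ℕ → MeasurableSpace Ω} (hanti : Antitone E) (hE : ∀ n, E n ∈ Lam μ)
    (h : ∀ n, Comm μ (E n) y) : Comm μ (⨅ n, E n) y := fun f hf => by
  have h1 := tendstoL1_condExp_iInf hanti hE (integrable_condExp (f := f) (m := y) (μ := μ))
  have h2 := (tendstoL1_condExp_iInf hanti hE hf).condExp
    (fun _ => integrable_condExp) integrable_condExp y
  exact h1.unique (h2.congr (fun n => (h n f hf).symm) (EventuallyEq.refl _ _))
    (fun _ => integrable_condExp) integrable_condExp integrable_condExp

/-- For a set A of the left side, commutation gives E[1_A|E n ⊓ y] = E[1_A|E n], which tends to 1_A;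
so A belongs to the right side. -/
theorem iSup_inf_eq_of_comm {E : ℕ → MeasurableSpace Ω} (hmono : Monotone E)
    (hE : ∀ n, E n ∈ Lam μ) (hy : y ∈ Lam μ) (h : ∀ n, Comm μ (E n) y) :
    (⨆ n, E n) ⊓ y = ⨆ n, E n ⊓ y := by
  have hmono' : Monotone fun n => E n ⊓ y := fun i j hij => inf_le_inf_right y (hmono hij)
  have hE' : ∀ n, E n ⊓ y ∈ Lam μ := fun n => inf_mem_lam (hE n) hy
  have hsup := (isMonotonicallyClosed_lam μ).iSup_mem E hmono hE
  refine le_antisymm ?_ (iSup_le fun n => inf_le_inf_right y (le_iSup E n))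
  refine le_of_condExp_ind (inf_le_right.trans hy.1)
    ((isMonotonicallyClosed_lam μ).iSup_mem _ hmono' hE') fun A hA => ?_
  have hAx := inf_le_left (b := y) A hA
  have hAy := inf_le_right (a := ⨆ n, E n) A hA
  have hAi := integrable_ind (μ := μ) (hy.1 A hAy)
  have h1 := tendstoL1_condExp_iSup (μ := μ) hmono (fun n => (hE n).1) (ind A)
  have h2 := tendstoL1_condExp_iSup (μ := μ) hmono' (fun n => (hE' n).1) (ind A)
  refine (h2.unique (h1.congr (fun n => ?_) (condExp_ind_self hsup.1 hAx))
    (fun _ => integrable_condExp) integrable_condExp hAi)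
  exact (condExp_congr_ae (condExp_ind_self hy.1 hAy)).symm.trans
    ((h n).condExp_condExp (hE n) hy hAi)

theorem indep_trivialField : Indep F (trivialField μ) μ := by
  rw [Indep_iff]
  rintro A S hA ⟨hS, h0 | h0⟩
  · rw [h0, mul_zero]
    exact measure_mono_null Set.inter_subset_right h0
  · have hS1 : μ S = 1 := by rwa [← prob_compl_eq_zero_iff hS]
    rw [hS1, mul_one]
    refine measure_congr (inter_ae_eq_left_of_ae_eq_univ ?_)
    exact ae_eq_univ.2 h0

/-- Conditioning an `x`-set on `y` amounts to conditioning it on the trivial field, so the result is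
constant. -/
theorem Comm.indep (h : Comm μ x y) (hx : x ∈ Lam μ) (hy : y ∈ Lam μ)
    (hxy : x ⊓ y = trivialField μ) : Indep x y μ := by
  rw [Indep_iff]
  intro A S hA hS
  have hAF := hx.1 A hA
  have hSF := hy.1 S hS
  have htriv : trivialField μ ≤ F := trivialField_le ⟨le_rfl, fun _ h _ => h⟩
  have h1 : μ[ind A|y] =ᵐ[μ] fun _ => μ.real A := by
    refine (condExp_congr_ae (condExp_ind_self hx.1 hA)).symm.trans ?_
    refine (h.symm.condExp_condExp hy hx (integrable_ind hAF)).trans ?_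
    rw [inf_comm, hxy]
    refine (condExp_indep_eq le_rfl htriv (stronglyMeasurable_const.indicator hAF)
      indep_trivialField).trans (Eventually.of_forall fun _ => ?_)
    exact integral_indicator_one hAF
  have h2 : μ.real (A ∩ S) = μ.real A * μ.real S := by
    calc μ.real (A ∩ S) = ∫ ω in S, ind A ω ∂μ := by
          rw [← integral_ind_mul hSF, Set.inter_comm]
          rw [← integral_indicator_one (hSF.inter hAF)]
          exact integral_congr_ae (Eventually.of_forall fun ω => congrFun (ind_inter S A) ω)
      _ = ∫ ω in S, (μ[ind A|y]) ω ∂μ := (setIntegral_condExp hy.1 (integrable_ind hAF) hS).symm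
      _ = ∫ ω in S, μ.real A ∂μ := setIntegral_congr_ae hSF (h1.mono fun ω hω _ => hω)
      _ = μ.real A * μ.real S := by simp [mul_comm]
  rw [← ENNReal.toReal_eq_toReal_iff' (measure_ne_top _ _)
    (ENNReal.mul_ne_top (measure_ne_top _ _) (measure_ne_top _ _)), ENNReal.toReal_mul]
  exact h2

end Comm

/-! ### Independence, conditional independence and distributivity -/

section CondIndep

variable {Ω : Type*} {a b x y y' z m F : MeasurableSpace Ω} {μ : Measure Ω}
  [IsProbabilityMeasure μ]

/-- As on a product space, conditioning acts on the two independent factors separately; over S ∩ S'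
both sides have integral P(A ∩ S) P(A' ∩ S'). -/
theorem condExp_ind_inter_sup (hy : y ≤ F) (hy' : y' ≤ F) (hind : Indep y y' μ) (ha : a ≤ y)
    (hb : b ≤ y') {A A' : Set Ω} (hA : MeasurableSet[y] A) (hA' : MeasurableSet[y'] A') :
    μ[ind (A ∩ A')|a ⊔ b] =ᵐ[μ] μ[ind A|a] * μ[ind A'|b] := by
  have haF := ha.trans hy
  have hbF := hb.trans hy'
  have hAF := hy A hA
  have hAF' := hy' A' hA'
  have hprod : ∀ f g : Ω → ℝ, StronglyMeasurable[y] f → StronglyMeasurable[y'] g →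
      ∫ ω, f ω * g ω ∂μ = (∫ ω, f ω ∂μ) * ∫ ω, g ω ∂μ := fun f g hf hg =>
    IndepFun.integral_fun_mul_eq_mul_integral
      (indep_of_indep_of_le_left (indep_of_indep_of_le_right hind hg.measurable.comap_le)
        hf.measurable.comap_le)
      (hf.mono hy).aestronglyMeasurable (hg.mono hy').aestronglyMeasurable
  have hint : Integrable (μ[ind A|a] * μ[ind A'|b]) μ :=
    integrable_condExp_ind_mul a A integrable_condExp
  have hmeas : StronglyMeasurable[a ⊔ b] (μ[ind A|a] * μ[ind A'|b]) :=
    (stronglyMeasurable_condExp.mono le_sup_left).mul (stronglyMeasurable_condExp.mono le_sup_right)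
  have hii := integrable_ind (μ := μ) (hAF.inter hAF')
  have hzero : ∀ S S', MeasurableSet[a] S → MeasurableSet[b] S' →
      ∫ ω in S ∩ S', (μ[ind A|a] * μ[ind A'|b] - ind (A ∩ A')) ω ∂μ = 0 := by
    intro S S' hS hS'
    have hSF := haF S hS
    have hSF' := hbF S' hS'
    have e1 : ∫ ω in S ∩ S', (μ[ind A|a] * μ[ind A'|b]) ω ∂μ
        = (∫ ω in S, ind A ω ∂μ) * ∫ ω in S', ind A' ω ∂μ := by
      rw [← setIntegral_condExp haF (integrable_ind hAF) hS,
        ← setIntegral_condExp hbF (integrable_ind hAF') hS', ← integral_ind_mul hSF,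
        ← integral_ind_mul hSF', ← integral_ind_mul (hSF.inter hSF'), ind_inter]
      refine Eq.trans ?_ (hprod _ _
        ((stronglyMeasurable_const.indicator (ha S hS)).mul (stronglyMeasurable_condExp.mono ha))
        ((stronglyMeasurable_const.indicator (hb S' hS')).mul
          (stronglyMeasurable_condExp.mono hb)))
      congr 1 with ω
      simp only [Pi.mul_apply]
      ring
    have e2 : ∫ ω in S ∩ S', ind (A ∩ A') ω ∂μ
        = (∫ ω in S, ind A ω ∂μ) * ∫ ω in S', ind A' ω ∂μ := by
      rw [← integral_ind_mul hSF, ← integral_ind_mul hSF', ← integral_ind_mul (hSF.inter hSF'),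
        ind_inter, ind_inter]
      refine Eq.trans ?_ (hprod _ _
        ((stronglyMeasurable_const.indicator (ha S hS)).mul
          (stronglyMeasurable_const.indicator hA))
        ((stronglyMeasurable_const.indicator (hb S' hS')).mul
          (stronglyMeasurable_const.indicator hA')))
      congr 1 with ω
      simp only [Pi.mul_apply]
      ring
    have e3 := integral_sub (hint.integrableOn (s := S ∩ S')) (hii.integrableOn (s := S ∩ S'))
    rw [e1, e2, sub_self] at e3
    exact e3
  refine condExp_eq_of_forall_setIntegral (sup_le haF hbF) hii hint
    (condExp_eq_self (sup_le haF hbF) hmeas hint) fun T hT => ?_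
  have := setIntegral_eq_zero_of_isPiSystem (μ := μ) (isPiSystem_inter a b)
    (sup_eq_generateFrom_inter a b) (sup_le haF hbF) (hint.sub hii) (by
      simpa using hzero Set.univ Set.univ MeasurableSet.univ MeasurableSet.univ) (by
      rintro _ ⟨S, hS, S', hS', rfl⟩
      exact hzero S S' hS hS') hT
  have e3 := integral_sub (hint.integrableOn (s := T)) (hii.integrableOn (s := T))
  exact sub_eq_zero.1 (e3.symm.trans this)

/-- Decreasing sequences of σ-fields inside two independent σ-fields: intersection commutes with
the join. -/
theorem iInf_sup_eq_of_indep {s t : ℕ → MeasurableSpace Ω} (hy : y ≤ F) (hy' : y' ≤ F)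
    (hind : Indep y y' μ) (hs : Antitone s) (ht : Antitone t) (hsL : ∀ n, s n ∈ Lam μ)
    (htL : ∀ n, t n ∈ Lam μ) (hsy : ∀ n, s n ≤ y) (hty : ∀ n, t n ≤ y') :
    ⨅ n, s n ⊔ t n = (⨅ n, s n) ⊔ ⨅ n, t n := by
  have hanti : Antitone fun n => s n ⊔ t n := fun i j hij => sup_le_sup (hs hij) (ht hij)
  have hL : ∀ n, s n ⊔ t n ∈ Lam μ := fun n => sup_mem_lam (hsL n) (htL n)
  have hle : (⨅ n, s n) ⊔ ⨅ n, t n ≤ ⨅ n, s n ⊔ t n :=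
    le_iInf fun n => sup_le_sup (iInf_le s n) (iInf_le t n)
  have hF : ⨅ n, s n ⊔ t n ≤ F := (iInf_mem_lam hL).1
  refine le_antisymm (le_of_condExp_ind hF
    (sup_mem_lam (iInf_mem_lam hsL) (iInf_mem_lam htL)) fun A hA => ?_) hle
  have hAyy : MeasurableSet[y ⊔ y'] A :=
    ((iInf_le (fun n => s n ⊔ t n) 0).trans (sup_le_sup (hsy 0) (hty 0))) A hA
  -- It suffices to compare the two conditionings on intersections of a `y`-set with a `y'`-set;
  -- there they split into products whose factors converge.
  refine (condExp_ind_eq_of_sup (sup_le hy hy') hle hF (fun S S' hS hS' => ?_) hAyy).symm.trans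
    (condExp_ind_self hF hA)
  have hSF := hy S hS
  have hSF' := hy' S' hS'
  have h1 := tendstoL1_condExp_iInf hanti hL (integrable_ind (μ := μ) (hSF.inter hSF'))
  have h2 := (tendstoL1_condExp_iInf hs hsL (integrable_ind (μ := μ) hSF)).mul
    (tendstoL1_condExp_iInf ht htL (integrable_ind (μ := μ) hSF'))
    (fun _ => integrable_condExp) integrable_condExp (fun _ => integrable_condExp)
    integrable_condExp (fun n => abs_condExp_ind_le (s n) S) (abs_condExp_ind_le _ S')
  refine (h1.unique (h2.congr (fun n => ?_) (EventuallyEq.refl _ _))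
    (fun _ => integrable_condExp) integrable_condExp
    (integrable_condExp_ind_mul _ S integrable_condExp)).trans ?_
  · exact (condExp_ind_inter_sup hy hy' hind (hsy n) (hty n) hS hS').symm
  · exact (condExp_ind_inter_sup hy hy' hind ((iInf_le s 0).trans (hsy 0))
      ((iInf_le t 0).trans (hty 0)) hS hS').symm

/-- Conditional independence of `x` and `z` given `y`. -/
def CondIndepGiven (μ : Measure Ω) (y x z : MeasurableSpace Ω) : Prop :=
  ∀ A A', MeasurableSet[x] A → MeasurableSet[z] A' →
    μ[ind (A ∩ A')|y] =ᵐ[μ] μ[ind A|y] * μ[ind A'|y]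

theorem CondIndepGiven.iSup {E : ℕ → MeasurableSpace Ω} (hmono : Monotone E)
    (hE : ∀ n, E n ∈ Lam μ) (h : ∀ n, CondIndepGiven μ (E n) x z) :
    CondIndepGiven μ (⨆ n, E n) x z := fun A A' hA hA' => by
  have hle : ∀ n, E n ≤ F := fun n => (hE n).1
  have h2 := (tendstoL1_condExp_iSup (μ := μ) hmono hle (ind A)).mul
    (tendstoL1_condExp_iSup (μ := μ) hmono hle (ind A'))
    (fun _ => integrable_condExp) integrable_condExp (fun _ => integrable_condExp)
    integrable_condExp (fun n => abs_condExp_ind_le _ A) (abs_condExp_ind_le _ A')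
  exact (tendstoL1_condExp_iSup (μ := μ) hmono hle (ind (A ∩ A'))).unique
    (h2.congr (fun n => (h n A A' hA hA').symm) (EventuallyEq.refl _ _))
    (fun _ => integrable_condExp) integrable_condExp
    (integrable_condExp_ind_mul _ A integrable_condExp)

theorem CondIndepGiven.iInf {E : ℕ → MeasurableSpace Ω} (hanti : Antitone E)
    (hE : ∀ n, E n ∈ Lam μ) (hx : x ≤ F) (hz : z ≤ F) (h : ∀ n, CondIndepGiven μ (E n) x z) :
    CondIndepGiven μ (⨅ n, E n) x z := fun A A' hA hA' => by
  have hAF := hx A hA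
  have hAF' := hz A' hA'
  have h2 := (tendstoL1_condExp_iInf hanti hE (integrable_ind (μ := μ) hAF)).mul
    (tendstoL1_condExp_iInf hanti hE (integrable_ind (μ := μ) hAF'))
    (fun _ => integrable_condExp) integrable_condExp (fun _ => integrable_condExp)
    integrable_condExp (fun n => abs_condExp_ind_le _ A) (abs_condExp_ind_le _ A')
  exact (tendstoL1_condExp_iInf hanti hE (integrable_ind (μ := μ) (hAF.inter hAF'))).unique
    (h2.congr (fun n => (h n A A' hA hA').symm) (EventuallyEq.refl _ _))
    (fun _ => integrable_condExp) integrable_condExp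
    (integrable_condExp_ind_mul _ A integrable_condExp)

/-- Moves `A` into the domain of integration, for the π-system argument that follows. -/
theorem setIntegral_condExp_ind_mul (hy : y ≤ F) {A A' S : Set Ω} (hA : MeasurableSet[F] A)
    (hS : MeasurableSet[y] S) :
    ∫ ω in S, (μ[ind A|y] * μ[ind A'|y]) ω ∂μ = ∫ ω in A, (ind S * μ[ind A'|y]) ω ∂μ := by
  have hi : Integrable (ind A * μ[ind A'|y]) μ := integrable_ind_mul hA integrable_condExp
  calc ∫ ω in S, (μ[ind A|y] * μ[ind A'|y]) ω ∂μ
      = ∫ ω in S, (μ[ind A * μ[ind A'|y]|y]) ω ∂μ := by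
        refine setIntegral_congr_ae (hy S hS) ?_
        filter_upwards [condExp_mul_of_stronglyMeasurable_right
          (stronglyMeasurable_condExp (f := ind A') (m := y) (μ := μ)) hi (integrable_ind hA)]
          with ω hω _ using hω.symm
    _ = ∫ ω in S, (ind A * μ[ind A'|y]) ω ∂μ := setIntegral_condExp hy hi hS
    _ = _ := by
        rw [← integral_ind_mul (hy S hS), ← integral_ind_mul hA]
        congr 1 with ω
        simp only [Pi.mul_apply]
        ring

theorem condExp_ind_inter_eq_mul_of_isPiSystem {C : Set (Set Ω)} (hC : IsPiSystem C)
    (hm : m = MeasurableSpace.generateFrom C) (hmF : m ≤ F) (hy : y ≤ F) {A' : Set Ω}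
    (hA' : MeasurableSet[F] A')
    (h : ∀ A ∈ C, μ[ind (A ∩ A')|y] =ᵐ[μ] μ[ind A|y] * μ[ind A'|y]) {A : Set Ω}
    (hA : MeasurableSet[m] A) : μ[ind (A ∩ A')|y] =ᵐ[μ] μ[ind A|y] * μ[ind A'|y] := by
  have hint : ∀ A, Integrable (μ[ind A|y] * μ[ind A'|y]) μ := fun A =>
    integrable_condExp_ind_mul y A integrable_condExp
  have hAi := integrable_ind (μ := μ) hA'
  refine condExp_eq_of_forall_setIntegral hy (integrable_ind ((hmF A hA).inter hA')) (hint A)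
    (condExp_eq_self hy (stronglyMeasurable_condExp.mul stronglyMeasurable_condExp) (hint A))
    fun S hS => ?_
  have hSF := hy S hS
  have hφ1 : Integrable (ind S * μ[ind A'|y]) μ := integrable_ind_mul hSF integrable_condExp
  have hφ2 : Integrable (ind S * ind A') μ := integrable_ind_mul hSF hAi
  have hswap : ∀ T, MeasurableSet[F] T →
      ∫ ω in S, ind (T ∩ A') ω ∂μ = ∫ ω in T, (ind S * ind A') ω ∂μ := by
    intro T hT
    rw [← integral_ind_mul hSF, ← integral_ind_mul hT, ind_inter]
    congr 1 with ω
    simp only [Pi.mul_apply]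
    ring
  rw [setIntegral_condExp_ind_mul hy (hmF A hA) hS, hswap A (hmF A hA), ← sub_eq_zero,
    ← integral_sub hφ1.integrableOn hφ2.integrableOn]
  refine setIntegral_eq_zero_of_isPiSystem hC hm hmF
    (φ := fun ω => (ind S * μ[ind A'|y]) ω - (ind S * ind A') ω) (hφ1.sub hφ2) ?_
    (fun T hT => ?_) hA
  · rw [integral_sub hφ1 hφ2, sub_eq_zero]
    have e1 := integral_ind_mul (μ := μ) hSF (μ[ind A'|y])
    have e2 := integral_ind_mul (μ := μ) hSF (ind A')
    rw [setIntegral_condExp hy hAi hS] at e1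
    exact e1.trans e2.symm
  · have hTF : MeasurableSet[F] T :=
      hmF T (hm ▸ MeasurableSpace.measurableSet_generateFrom hT)
    rw [integral_sub hφ1.integrableOn hφ2.integrableOn, sub_eq_zero, ← hswap T hTF,
      ← setIntegral_condExp_ind_mul hy hTF hS,
      ← setIntegral_condExp hy (integrable_ind (hTF.inter hA')) hS]
    exact setIntegral_congr_ae hSF ((h T hT).symm.mono fun ω hω _ => hω)

/-- On generators S ∩ S' of `x` and T ∩ T' of `z`, split along y and y', conditioning on `y` keeps
S, T and replaces S', T' by probabilities; P(S' ∩ T') = P(S') P(T') since `x` and `z` are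
independent. -/
theorem condIndepGiven_of_indep (hx : x ≤ F) (hz : z ≤ F) (hy : y ≤ F) (hy' : y' ≤ F)
    (hyy' : Indep y' y μ) (hxz : Indep x z μ) (hx2 : x = (x ⊓ y) ⊔ (x ⊓ y'))
    (hz2 : z = (z ⊓ y) ⊔ (z ⊓ y')) : CondIndepGiven μ y x z := by
  have key : ∀ S S' T T', MeasurableSet[x ⊓ y] S → MeasurableSet[x ⊓ y'] S' →
      MeasurableSet[z ⊓ y] T → MeasurableSet[z ⊓ y'] T' →
      μ[ind ((S ∩ S') ∩ (T ∩ T'))|y] =ᵐ[μ] μ[ind (S ∩ S')|y] * μ[ind (T ∩ T')|y] := by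
    intro S S' T T' hS hS' hT hT'
    have hSy := inf_le_right (a := x) S hS
    have hTy := inf_le_right (a := z) T hT
    have hSy' := inf_le_right (a := x) S' hS'
    have hTy' := inf_le_right (a := z) T' hT'
    have hμ : μ.real (S' ∩ T') = μ.real S' * μ.real T' := by
      have := (Indep_iff x z μ).1 hxz S' T' (inf_le_left (b := y') S' hS')
        (inf_le_left (b := y') T' hT')
      simp only [Measure.real, this, ENNReal.toReal_mul]
    rw [Set.inter_inter_inter_comm]
    filter_upwards [condExp_ind_inter_of_indep hy hy' hyy' (MeasurableSet.inter hSy hTy)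
        (MeasurableSet.inter hSy' hTy'), condExp_ind_inter_of_indep hy hy' hyy' hSy hSy',
      condExp_ind_inter_of_indep hy hy' hyy' hTy hTy'] with ω h1 h2 h3
    rw [h1, Pi.mul_apply, h2, h3, ind_inter, Pi.mul_apply, hμ]
    ring
  -- The extension from generators is made in one argument at a time.
  have key2 : ∀ A T T', MeasurableSet[x] A → MeasurableSet[z ⊓ y] T → MeasurableSet[z ⊓ y'] T' →
      μ[ind (A ∩ (T ∩ T'))|y] =ᵐ[μ] μ[ind A|y] * μ[ind (T ∩ T')|y] := by
    intro A T T' hA hT hT'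
    refine condExp_ind_inter_eq_mul_of_isPiSystem (isPiSystem_inter _ _)
      (hx2.trans (sup_eq_generateFrom_inter _ _)) hx hy
      (MeasurableSet.inter (hy _ (inf_le_right (a := z) T hT))
        (hy' _ (inf_le_right (a := z) T' hT'))) ?_ hA
    rintro _ ⟨S, hS, S', hS', rfl⟩
    exact key S S' T T' hS hS' hT hT'
  intro A A' hA hA'
  rw [Set.inter_comm, mul_comm]
  refine condExp_ind_inter_eq_mul_of_isPiSystem (isPiSystem_inter _ _)
      (hz2.trans (sup_eq_generateFrom_inter _ _)) hz hy (hx A hA) ?_ hA'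
  rintro _ ⟨T, hT, T', hT', rfl⟩
  have := key2 A T T' hA hT hT'
  rwa [Set.inter_comm, mul_comm] at this

/-- Conditional independence and commutation give E[1_A 1_A'|y] = E[1_A|y ⊓ x] E[1_A'|y ⊓ z], a
function measurable for (y ⊓ x) ⊔ (y ⊓ z). Thus `y` and this smaller field give the same
conditioning on all of x ⊔ z. -/
theorem CondIndepGiven.inf_sup_eq (h : CondIndepGiven μ y x z) (hx : x ∈ Lam μ) (hy : y ∈ Lam μ)
    (hz : z ∈ Lam μ) (hxy : Comm μ x y) (hzy : Comm μ z y) :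
    y ⊓ (x ⊔ z) = (y ⊓ x) ⊔ (y ⊓ z) := by
  have hwy : (y ⊓ x) ⊔ (y ⊓ z) ≤ y := sup_le inf_le_left inf_le_left
  have hw : (y ⊓ x) ⊔ (y ⊓ z) ∈ Lam μ := sup_mem_lam (inf_mem_lam hy hx) (inf_mem_lam hy hz)
  refine le_antisymm (le_of_condExp_ind (inf_le_left.trans hy.1) hw fun S hS => ?_) le_inf_sup
  have hSy := inf_le_left (b := x ⊔ z) S hS
  refine (condExp_ind_eq_of_sup (sup_le hx.1 hz.1) hwy hy.1 (fun A A' hA hA' => ?_)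
    (inf_le_right (a := y) S hS)).symm.trans (condExp_ind_self hy.1 hSy)
  have hmeas : ∀ {v A}, v ∈ Lam μ → Comm μ v y → MeasurableSet[v] A →
      μ[ind A|y] =ᵐ[μ] μ[ind A|y ⊓ v] := fun {v A} hv hvy hA =>
    (condExp_congr_ae (condExp_ind_self hv.1 hA)).symm.trans
      (hvy.symm.condExp_condExp hy hv (integrable_ind (hv.1 A hA)))
  have hprod : μ[ind (A ∩ A')|y] =ᵐ[μ] μ[ind A|y ⊓ x] * μ[ind A'|y ⊓ z] :=
    (h A A' hA hA').trans ((hmeas hx hxy hA).mul (hmeas hz hzy hA'))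
  have hsm : StronglyMeasurable[(y ⊓ x) ⊔ (y ⊓ z)] (μ[ind A|y ⊓ x] * μ[ind A'|y ⊓ z]) :=
    (stronglyMeasurable_condExp.mono le_sup_left).mul (stronglyMeasurable_condExp.mono le_sup_right)
  calc μ[ind (A ∩ A')|y] =ᵐ[μ] μ[ind A|y ⊓ x] * μ[ind A'|y ⊓ z] := hprod
    _ =ᵐ[μ] μ[μ[ind A|y ⊓ x] * μ[ind A'|y ⊓ z]|(y ⊓ x) ⊔ (y ⊓ z)] :=
        (condExp_eq_self hw.1 hsm (integrable_condExp_ind_mul _ A integrable_condExp)).symm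
    _ =ᵐ[μ] μ[μ[ind (A ∩ A')|y]|(y ⊓ x) ⊔ (y ⊓ z)] := condExp_congr_ae hprod.symm
    _ =ᵐ[μ] μ[ind (A ∩ A')|(y ⊓ x) ⊔ (y ⊓ z)] := condExp_condExp_of_le hwy hy.1

end CondIndep

/-! ### The monotone closure and its complemented elements -/

section Closure

variable {Ω : Type*} {x y z x' y' F : MeasurableSpace Ω} {μ : Measure Ω}
  {B : Set (MeasurableSpace Ω)}

theorem monotoneClosure_subset_lam (hB : B ⊆ Lam μ) : monotoneClosure μ B ⊆ Lam μ :=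
  (isLeast_monotoneClosure μ B hB).1.1.subset_lam

theorem subset_monotoneClosure : B ⊆ monotoneClosure μ B :=
  Set.subset_sInter fun _ hZ => hZ.2

theorem monotoneClosure_induction (hB : B ⊆ Lam μ) {P : MeasurableSpace Ω → Prop}
    (base : ∀ x ∈ B, P x)
    (iInf : ∀ E : ℕ → MeasurableSpace Ω, Antitone E → (∀ n, E n ∈ monotoneClosure μ B) →
      (∀ n, P (E n)) → P (⨅ n, E n))
    (iSup : ∀ E : ℕ → MeasurableSpace Ω, Monotone E → (∀ n, E n ∈ monotoneClosure μ B) →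
      (∀ n, P (E n)) → P (⨆ n, E n)) :
    ∀ x ∈ monotoneClosure μ B, P x := by
  have hD := (isLeast_monotoneClosure μ B hB).1.1
  have hZ : IsMonotonicallyClosed μ {x | x ∈ monotoneClosure μ B ∧ P x} :=
    { subset_lam := fun x hx => hD.subset_lam hx.1
      iInf_mem := fun E hE h =>
        ⟨hD.iInf_mem E hE fun n => (h n).1, iInf E hE (fun n => (h n).1) fun n => (h n).2⟩
      iSup_mem := fun E hE h =>
        ⟨hD.iSup_mem E hE fun n => (h n).1, iSup E hE (fun n => (h n).1) fun n => (h n).2⟩ }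
  exact fun x hx => (hx _ ⟨hZ, fun y hy => ⟨subset_monotoneClosure hy, base y hy⟩⟩).2

theorem IsComplementPair.symm (h : IsComplementPair μ x y) : IsComplementPair μ y x :=
  ⟨inf_comm x y ▸ h.1, sup_comm x y ▸ h.2⟩

/-- The elements of the monotone closure that have a complement there. -/
def completion (μ : Measure Ω) (B : Set (MeasurableSpace Ω)) : Set (MeasurableSpace Ω) :=
  {E | E ∈ monotoneClosure μ B ∧ ∃ E' ∈ monotoneClosure μ B, IsComplementPair μ E E'}

namespace IsNoiseTypeBooleanAlgebra

theorem eq_inf_sup_inf_of_mem (hB : IsNoiseTypeBooleanAlgebra μ B) (hx : x ∈ B) (hy : y ∈ B)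
    (hy' : y' ∈ B) (h : IsComplementPair μ y y') : x = (x ⊓ y) ⊔ (x ⊓ y') := by
  rw [← hB.distrib x hx y hy y' hy', h.2]
  exact (inf_eq_left.2 (hB.subset_lam hx).1).symm

theorem subset_completion (hB : IsNoiseTypeBooleanAlgebra μ B) : B ⊆ completion μ B :=
  fun x hx => by
    obtain ⟨x', hx', h⟩ := hB.exists_compl x hx
    exact ⟨subset_monotoneClosure hx, x', subset_monotoneClosure hx', h⟩

variable [IsProbabilityMeasure μ]

theorem comm_of_mem (hB : IsNoiseTypeBooleanAlgebra μ B) (hx : x ∈ B) (hy : y ∈ B) :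
    Comm μ x y := by
  have half : ∀ {x y}, x ∈ B → y ∈ B → ∀ f : Ω → ℝ, Integrable f μ → μ[μ[f|y]|x] =ᵐ[μ] μ[f|x ⊓ y] := by
    intro x y hx hy f hf
    obtain ⟨y', hy', h⟩ := hB.exists_compl y hy
    have hL := fun {z} (hz : z ∈ B) => (hB.subset_lam hz).1
    exact condExp_condExp_of_forall_ind (hL hx) (hL hy) (fun A hA =>
      condExp_ind_of_eq_sup (hL hx) (hL hy) (hL hy')
        (hB.indep y' hy' y hy h.symm.1) (hB.eq_inf_sup_inf_of_mem hx hy hy' h) hA) hf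
  intro f hf
  have h2 := half hy hx f hf
  rw [inf_comm] at h2
  exact (half hx hy f hf).trans h2.symm

/-- Induction in one variable at a time: first from B × B to B̃ × B, then, by symmetry, to B̃ × B̃.
-/
theorem comm_of_mem_monotoneClosure (hB : IsNoiseTypeBooleanAlgebra μ B)
    (hx : x ∈ monotoneClosure μ B) (hy : y ∈ monotoneClosure μ B) : Comm μ x y := by
  have hL := monotoneClosure_subset_lam hB.subset_lam
  have step : ∀ y, (∀ x ∈ B, Comm μ x y) → ∀ x ∈ monotoneClosure μ B, Comm μ x y :=
    fun y hy => monotoneClosure_induction hB.subset_lam hy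
      (fun E hE hD h => Comm.iInf hE (fun n => hL (hD n)) h)
      (fun E hE hD h => Comm.iSup hE (fun n => hL (hD n)) h)
  refine step y (fun x hx => ?_) x hx
  exact (step x (fun z hz => hB.comm_of_mem hz hx) y hy).symm

theorem inf_mem_monotoneClosure (hB : IsNoiseTypeBooleanAlgebra μ B)
    (hx : x ∈ monotoneClosure μ B) (hy : y ∈ monotoneClosure μ B) :
    x ⊓ y ∈ monotoneClosure μ B := by
  have hL := monotoneClosure_subset_lam hB.subset_lam
  have hD := (isLeast_monotoneClosure μ B hB.subset_lam).1.1
  have step : ∀ y ∈ monotoneClosure μ B, (∀ x ∈ B, x ⊓ y ∈ monotoneClosure μ B) →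
      ∀ x ∈ monotoneClosure μ B, x ⊓ y ∈ monotoneClosure μ B := by
    intro y hy hBy
    refine monotoneClosure_induction hB.subset_lam hBy (fun E hE hED h => ?_)
      (fun E hE hED h => ?_)
    · rw [iInf_inf]
      exact hD.iInf_mem _ (fun i j hij => inf_le_inf_right y (hE hij)) h
    · rw [iSup_inf_eq_of_comm hE (fun n => hL (hED n)) (hL hy)
        fun n => hB.comm_of_mem_monotoneClosure (hED n) hy]
      exact hD.iSup_mem _ (fun i j hij => inf_le_inf_right y (hE hij)) h
  refine step y hy (fun x hx => ?_) x hx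
  rw [inf_comm]
  refine step x (subset_monotoneClosure hx) (fun z hz => ?_) y hy
  exact subset_monotoneClosure (hB.inf_mem z hz x hx)

theorem indep_of_mem_monotoneClosure (hB : IsNoiseTypeBooleanAlgebra μ B)
    (hx : x ∈ monotoneClosure μ B) (hy : y ∈ monotoneClosure μ B)
    (h : x ⊓ y = trivialField μ) : Indep x y μ :=
  (hB.comm_of_mem_monotoneClosure hx hy).indep (monotoneClosure_subset_lam hB.subset_lam hx)
    (monotoneClosure_subset_lam hB.subset_lam hy) h

/-- Increasing limits are formal; decreasing ones work because the two parts lie in the independent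
fields `y` and `y'`. -/
theorem eq_inf_sup_inf (hB : IsNoiseTypeBooleanAlgebra μ B) (hy : y ∈ B) (hy' : y' ∈ B)
    (h : IsComplementPair μ y y') :
    ∀ x ∈ monotoneClosure μ B, x = (x ⊓ y) ⊔ (x ⊓ y') := by
  have hL := monotoneClosure_subset_lam hB.subset_lam
  have hyL := hB.subset_lam hy
  have hyL' := hB.subset_lam hy'
  refine monotoneClosure_induction hB.subset_lam
    (fun x hx => hB.eq_inf_sup_inf_of_mem hx hy hy' h) (fun E hE hED ih => ?_)
    (fun E hE hED ih => ?_)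
  · rw [iInf_inf, iInf_inf, ← iInf_sup_eq_of_indep hyL.1 hyL'.1 (hB.indep y hy y' hy' h.1)
      (fun i j hij => inf_le_inf_right y (hE hij)) (fun i j hij => inf_le_inf_right y' (hE hij))
      (fun n => inf_mem_lam (hL (hED n)) hyL) (fun n => inf_mem_lam (hL (hED n)) hyL')
      (fun n => inf_le_right) (fun n => inf_le_right)]
    exact iInf_congr ih
  · refine le_antisymm (iSup_le fun n => ?_) (sup_le inf_le_left inf_le_left)
    rw [ih n]
    exact sup_le_sup (inf_le_inf_right y (le_iSup E n)) (inf_le_inf_right y' (le_iSup E n))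

/-- Conditional independence, unlike the distributive law it implies, passes directly to monotone
limits in `y`; so it is what the induction on `y` carries. -/
theorem condIndepGiven (hB : IsNoiseTypeBooleanAlgebra μ B)
    (hx : x ∈ monotoneClosure μ B) (hz : z ∈ monotoneClosure μ B)
    (hxz : x ⊓ z = trivialField μ) : ∀ y ∈ monotoneClosure μ B, CondIndepGiven μ y x z := by
  have hL := monotoneClosure_subset_lam hB.subset_lam
  refine monotoneClosure_induction hB.subset_lam (fun y hy => ?_)
    (fun E hE hED ih => CondIndepGiven.iInf hE (fun n => hL (hED n)) (hL hx).1 (hL hz).1 ih)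
    (fun E hE hED ih => CondIndepGiven.iSup hE (fun n => hL (hED n)) ih)
  obtain ⟨y', hy', h⟩ := hB.exists_compl y hy
  exact condIndepGiven_of_indep (hL hx).1 (hL hz).1 (hB.subset_lam hy).1 (hB.subset_lam hy').1
    (hB.indep y' hy' y hy h.symm.1) (hB.indep_of_mem_monotoneClosure hx hz hxz)
    (hB.eq_inf_sup_inf hy hy' h x hx) (hB.eq_inf_sup_inf hy hy' h z hz)

/-- Distributivity over joins of disjoint elements of the monotone closure. -/
theorem inf_sup_eq_of_disjoint (hB : IsNoiseTypeBooleanAlgebra μ B)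
    (hy : y ∈ monotoneClosure μ B) (hx : x ∈ monotoneClosure μ B)
    (hz : z ∈ monotoneClosure μ B) (hxz : x ⊓ z = trivialField μ) :
    y ⊓ (x ⊔ z) = (y ⊓ x) ⊔ (y ⊓ z) := by
  have hL := monotoneClosure_subset_lam hB.subset_lam
  exact (hB.condIndepGiven hx hz hxz y hy).inf_sup_eq (hL hx) (hL hy) (hL hz)
    (hB.comm_of_mem_monotoneClosure hx hy) (hB.comm_of_mem_monotoneClosure hz hy)

theorem eq_inf_sup_inf_of_isComplementPair (hB : IsNoiseTypeBooleanAlgebra μ B)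
    (hy : y ∈ monotoneClosure μ B) (hx : x ∈ monotoneClosure μ B)
    (hx' : x' ∈ monotoneClosure μ B) (h : IsComplementPair μ x x') :
    y = (y ⊓ x) ⊔ (y ⊓ x') := by
  rw [← hB.inf_sup_eq_of_disjoint hy hx hx' h.1, h.2]
  exact (inf_eq_left.2 (monotoneClosure_subset_lam hB.subset_lam hy).1).symm

theorem isComplementPair_le (hB : IsNoiseTypeBooleanAlgebra μ B)
    (hx : x ∈ monotoneClosure μ B) (hy : y ∈ monotoneClosure μ B)
    (hz : z ∈ monotoneClosure μ B) (hxy : IsComplementPair μ x y)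
    (hxz : IsComplementPair μ x z) : y ≤ z := by
  have hL := monotoneClosure_subset_lam hB.subset_lam
  rw [hB.eq_inf_sup_inf_of_isComplementPair hy hx hz hxz, hxy.symm.1]
  exact sup_le (trivialField_le (hL hz)) inf_le_right

/-- Uniqueness of complements in the monotone closure. -/
theorem isComplementPair_unique (hB : IsNoiseTypeBooleanAlgebra μ B)
    (hx : x ∈ monotoneClosure μ B) (hy : y ∈ monotoneClosure μ B)
    (hz : z ∈ monotoneClosure μ B) (hxy : IsComplementPair μ x y)
    (hxz : IsComplementPair μ x z) : y = z :=
  le_antisymm (hB.isComplementPair_le hx hy hz hxy hxz) (hB.isComplementPair_le hx hz hy hxz hxy)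

/-- Rewrites a join as one of disjoint, hence independent, elements, to which the preceding results
apply. -/
theorem sup_inf_compl_eq (hB : IsNoiseTypeBooleanAlgebra μ B)
    (hy : y ∈ monotoneClosure μ B) (hx : x ∈ monotoneClosure μ B)
    (hx' : x' ∈ monotoneClosure μ B) (h : IsComplementPair μ x x') :
    x ⊔ (y ⊓ x') = x ⊔ y := by
  refine le_antisymm (sup_le_sup_left inf_le_left x) (sup_le le_sup_left ?_)
  calc y = (y ⊓ x) ⊔ (y ⊓ x') := hB.eq_inf_sup_inf_of_isComplementPair hy hx hx' h
    _ ≤ x ⊔ (y ⊓ x') := sup_le_sup_right inf_le_right _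

/-- The complement of `x` serves for decreasing limits: x ⊔ E n = x ⊔ (E n ⊓ x'), with x and x'
independent. -/
theorem sup_mem_monotoneClosure (hB : IsNoiseTypeBooleanAlgebra μ B)
    (hx : x ∈ completion μ B) (hy : y ∈ monotoneClosure μ B) :
    x ⊔ y ∈ monotoneClosure μ B := by
  have hL := monotoneClosure_subset_lam hB.subset_lam
  have hD := (isLeast_monotoneClosure μ B hB.subset_lam).1.1
  have step : ∀ x ∈ completion μ B, (∀ y ∈ B, x ⊔ y ∈ monotoneClosure μ B) →
      ∀ y ∈ monotoneClosure μ B, x ⊔ y ∈ monotoneClosure μ B := by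
    rintro x ⟨hx, x', hx', h⟩ hBx
    refine monotoneClosure_induction hB.subset_lam hBx (fun E hE hED ih => ?_)
      (fun E hE hED ih => ?_)
    · have e : x ⊔ ⨅ n, E n = ⨅ n, x ⊔ E n := by
        rw [← hB.sup_inf_compl_eq (hD.iInf_mem E hE hED) hx hx' h, iInf_inf]
        have := iInf_sup_eq_of_indep (s := fun _ => x) (t := fun n => E n ⊓ x') (hL hx).1 (hL hx').1
          (hB.indep_of_mem_monotoneClosure hx hx' h.1) antitone_const
          (fun i j hij => inf_le_inf_right x' (hE hij)) (fun _ => hL hx)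
          (fun n => inf_mem_lam (hL (hED n)) (hL hx')) (fun _ => le_rfl) (fun _ => inf_le_right)
        rw [iInf_const] at this
        rw [← this]
        exact iInf_congr fun n => hB.sup_inf_compl_eq (hED n) hx hx' h
      rw [e]
      exact hD.iInf_mem _ (fun i j hij => sup_le_sup_left (hE hij) x) ih
    · rw [sup_iSup]
      exact hD.iSup_mem _ (fun i j hij => sup_le_sup_left (hE hij) x) ih
  refine step x hx (fun y hy => ?_) y hy
  -- Elements of B are complemented, so for `y` in B the roles can be exchanged and the induction
  -- run over `x`.
  rw [sup_comm]
  exact step y (hB.subset_completion hy)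
    (fun z hz => subset_monotoneClosure (hB.sup_mem y hy z hz)) x hx.1

theorem isComplementPair_sup_inf (hB : IsNoiseTypeBooleanAlgebra μ B)
    (hx : x ∈ monotoneClosure μ B) (hy : y ∈ monotoneClosure μ B)
    (hx' : x' ∈ monotoneClosure μ B) (hy' : y' ∈ monotoneClosure μ B)
    (h : IsComplementPair μ x x') (h' : IsComplementPair μ y y') :
    IsComplementPair μ (x ⊔ y) (x' ⊓ y') := by
  have hL := monotoneClosure_subset_lam hB.subset_lam
  have hw := hB.inf_mem_monotoneClosure hx' hy'
  constructor
  · refine le_antisymm ?_ (trivialField_le (inf_mem_lam (sup_mem_lam (hL hx) (hL hy)) (hL hw)))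
    have hdisj : x ⊓ (y ⊓ x') = trivialField μ :=
      le_antisymm ((inf_le_inf_left x inf_le_right).trans h.1.le)
        (trivialField_le (inf_mem_lam (hL hx) (inf_mem_lam (hL hy) (hL hx'))))
    -- Distributing x' ⊓ y' over the disjoint join x ⊔ (y ⊓ x') leaves two pieces, below x' ⊓ x and
    -- y' ⊓ y.
    rw [inf_comm, ← hB.sup_inf_compl_eq hy hx hx' h,
      hB.inf_sup_eq_of_disjoint hw hx (hB.inf_mem_monotoneClosure hy hx') hdisj]
    exact sup_le ((inf_le_inf_right x inf_le_left).trans h.symm.1.le)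
      ((inf_le_inf inf_le_right inf_le_left).trans h'.symm.1.le)
  · refine le_antisymm (sup_le (sup_le (hL hx).1 (hL hy).1) (hL hw).1) ?_
    calc F = x ⊔ x' := h.2.symm
      _ = x ⊔ ((x' ⊓ y) ⊔ (x' ⊓ y')) := by
          rw [← hB.eq_inf_sup_inf_of_isComplementPair hx' hy hy' h']
      _ ≤ (x ⊔ y) ⊔ (x' ⊓ y') := sup_le (le_sup_left.trans le_sup_left)
          (sup_le_sup_right (inf_le_right.trans le_sup_right) _)

theorem sup_mem_completion (hB : IsNoiseTypeBooleanAlgebra μ B)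
    (hx : x ∈ completion μ B) (hy : y ∈ completion μ B) : x ⊔ y ∈ completion μ B := by
  obtain ⟨hyD, y', hy', h'⟩ := hy
  have hs := hB.sup_mem_monotoneClosure hx hyD
  obtain ⟨hxD, x', hx', h⟩ := hx
  exact ⟨hs, x' ⊓ y', hB.inf_mem_monotoneClosure hx' hy',
    hB.isComplementPair_sup_inf hxD hyD hx' hy' h h'⟩

theorem inf_mem_completion (hB : IsNoiseTypeBooleanAlgebra μ B)
    (hx : x ∈ completion μ B) (hy : y ∈ completion μ B) : x ⊓ y ∈ completion μ B := by
  obtain ⟨hxD, x', hx', h⟩ := hx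
  obtain ⟨hyD, y', hy', h'⟩ := hy
  exact ⟨hB.inf_mem_monotoneClosure hxD hyD, x' ⊔ y',
    hB.sup_mem_monotoneClosure ⟨hx', x, hxD, h.symm⟩ hy',
    (hB.isComplementPair_sup_inf hx' hy' hxD hyD h.symm h'.symm).symm⟩

/-- The complemented elements of the monotone closure form a noise-type Boolean algebra. -/
theorem completion_isNoiseTypeBooleanAlgebra (hB : IsNoiseTypeBooleanAlgebra μ B) :
    IsNoiseTypeBooleanAlgebra μ (completion μ B) where
  subset_lam x hx := monotoneClosure_subset_lam hB.subset_lam hx.1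
  inf_mem x hx y hy := hB.inf_mem_completion hx hy
  sup_mem x hx y hy := hB.sup_mem_completion hx hy
  trivial_mem := hB.subset_completion hB.trivial_mem
  whole_mem := hB.subset_completion hB.whole_mem
  distrib x hx y hy z hz := by
    obtain ⟨y', hy', h⟩ := hy.2
    have hL := monotoneClosure_subset_lam hB.subset_lam
    have hdisj : y ⊓ (z ⊓ y') = trivialField μ :=
      le_antisymm ((inf_le_inf_left y inf_le_right).trans h.1.le)
        (trivialField_le (inf_mem_lam (hL hy.1) (inf_mem_lam (hL hz.1) (hL hy'))))
    refine le_antisymm ?_ le_inf_sup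
    -- Full distributivity reduces to the disjoint case through y ⊔ z = y ⊔ (z ⊓ y').
    rw [← hB.sup_inf_compl_eq hz.1 hy.1 hy' h,
      hB.inf_sup_eq_of_disjoint hx.1 hy.1 (hB.inf_mem_monotoneClosure hz.1 hy') hdisj]
    exact sup_le_sup_left (inf_le_inf_left x inf_le_left) _
  exists_compl x hx := by
    obtain ⟨hxD, x', hx', h⟩ := hx
    exact ⟨x', ⟨hx', x, hxD, h.symm⟩, h⟩
  indep x hx y hy h := hB.indep_of_mem_monotoneClosure hx.1 hy.1 h

theorem isNoiseTypeCompletion (hB : IsNoiseTypeBooleanAlgebra μ B) :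
    IsNoiseTypeCompletion μ B (completion μ B) := by
  refine ⟨⟨hB.completion_isNoiseTypeBooleanAlgebra, hB.subset_completion, fun Z hZ hBZ x hx => hx.1 Z ⟨hZ, hBZ⟩⟩, ?_⟩
  rintro D ⟨hD, -, hdense⟩ x hx
  have hsub : D ⊆ monotoneClosure μ B := fun y hy Z hZ => hdense Z hZ.1 hZ.2 hy
  obtain ⟨x', hx', h⟩ := hD.exists_compl x hx
  exact ⟨hsub hx, x', hsub hx', h⟩

end IsNoiseTypeBooleanAlgebra

end Closure

end NoiseAlgebra

theorem theorem2 {Ω : Type*} {F : MeasurableSpace Ω} (μ : Measure Ω) [IsProbabilityMeasure μ]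
    [TopologicalSpace.SeparableSpace (Lp ℝ 2 μ)]
    (B : Set (MeasurableSpace Ω)) (hB : NoiseAlgebra.IsNoiseTypeBooleanAlgebra μ B) :
    (∃ C : Set (MeasurableSpace Ω), NoiseAlgebra.IsNoiseTypeCompletion μ B C) ∧
    (∀ C : Set (MeasurableSpace Ω), NoiseAlgebra.IsNoiseTypeCompletion μ B C →
      ∀ E ∈ NoiseAlgebra.Lam μ,
        (E ∈ C ↔ E ∈ NoiseAlgebra.monotoneClosure μ B ∧
          ∃ E' ∈ NoiseAlgebra.monotoneClosure μ B, NoiseAlgebra.IsComplementPair μ E E')) ∧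
    (∀ E ∈ NoiseAlgebra.monotoneClosure μ B,
      ∀ E₁ ∈ NoiseAlgebra.monotoneClosure μ B, ∀ E₂ ∈ NoiseAlgebra.monotoneClosure μ B,
        NoiseAlgebra.IsComplementPair μ E E₁ → NoiseAlgebra.IsComplementPair μ E E₂ →
          E₁ = E₂) := by
  refine ⟨⟨_, hB.isNoiseTypeCompletion⟩, fun C hC E _ => ?_, fun E hE E₁ hE₁ E₂ hE₂ h₁ h₂ =>
    hB.isComplementPair_unique hE hE₁ hE₂ h₁ h₂⟩
  rw [hC.unique hB.isNoiseTypeCompletion]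
  exact Iff.rfl
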